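/- Let $(\overline M,\overline g)$ be a semi-Riemannian manifold of dimension $n+1$ with Levi-Civita connection $\overline\nabla$, and let $x:M\to\overline M$ be a null hypersurface, i.e. an embedded hypersurface whose induced metric $g=x^{*}\overline g$ is degenerate at every point. Let $N$ be a null rigging for $M$: a smooth vector field along $M$ which is lightlike and nowhere tangent to $M$. Put $\eta=x^{*}\overline g(N,\cdot)$, let $\mathcal S(TM)=\ker\eta$ be the screen distribution, and let $\xi$ be the rigged vector field, i.e. the unique section of $TM^{\perp}\subset TM$ with $\overline g(\xi,N)=1$. Let $\nabla=\nabla^{N}$ be the connection on $M$ obtained from $\overline\nabla$ by projection onto $TM$ along $\operatorname{span}(N)$; let $A_N$ and $\tau$ be given by $\overline\nabla_XN=-A_NX+\tau(X)N$, $\tau(X)=\overline g(\overline\nabla_XN,\xi)$, and let $\stackrel{\star}{A}_\xi$ be given by $\stackrel{\star}{A}_\xi X=-P\nabla_X\xi$, where $P:TM\to\mathcal S(TM)$ is the projection along $\xi$ (equivalently $\nabla_X\xi=-\stackrel{\star}{A}_\xi X-\tau(X)\xi$). For a smooth function $\alpha$ on $M$, say that $(N,\alpha)$ satisfies the coincidence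 conditions if $$\stackrel{\star}{A}_\xi=\alpha A_N\quad\text{and}\quad 2\alpha\,\tau(\xi)+d\alpha(\xi)=0 .\qquad(\ast)$$ If $\alpha$ vanishes nowhere, let $\nabla_\alpha$ be the Levi-Civita connection of the $\alpha$-associated metric $g_\alpha=g+\alpha\,\eta\otimes\eta$. Let $\phi$ be a smooth nowhere vanishing function on $M$ which is constant on each leaf of the screen distribution, i.e. constant along every smooth curve tangent to $\mathcal S(TM)$. Then $\phi N$ is again a null rigging for $M$, and: 1. if $(N,\alpha)$ satisfies $(\ast)$, then $(\phi N,\alpha/\phi^{2})$ satisfies $(\ast)$ (with all objects formed with respect to the rigging $\phi N$); 2. if $\alpha$ vanishes nowhere and $\nabla_\alpha=\nabla^{N}$, then $\nabla_{\alpha/\phi^{2}}=\nabla^{\phi N}$, where $\nabla_{\alpha/\phi^{2}}$ is the Levi-Civita connection of the $(\alpha/\phi^{2})$-associated metric of the rigging $\phi N$. -/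

import Mathlib

open scoped Manifold ContDiff Topology
open Bundle

noncomputable section

namespace NullHypersurface

/-- A semi-Riemannian metric on a `d`-dimensional smooth manifold: a smooth field of
symmetric nondegenerate bilinear forms on the tangent spaces. -/
structure SemiRiemannianMetric (d : ℕ) (M : Type*) [TopologicalSpace M]
    [ChartedSpace (EuclideanSpace ℝ (Fin d)) M] [IsManifold (𝓡 d) ∞ M] where
  /-- The bilinear form on each tangent space. -/
  val (p : M) : TangentSpace (𝓡 d) p →L[ℝ] TangentSpace (𝓡 d) p →L[ℝ] ℝ
  symm (p : M) (u v : TangentSpace (𝓡 d) p) : val p u v = val p v u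
  nondegenerate (p : M) (u : TangentSpace (𝓡 d) p) (hu : ∀ v, val p u v = 0) : u = 0
  contMDiff : ContMDiff (𝓡 d)
    ((𝓡 d).prod 𝓘(ℝ, EuclideanSpace ℝ (Fin d) →L[ℝ] EuclideanSpace ℝ (Fin d) →L[ℝ] ℝ)) ∞
    (fun p : M ↦ TotalSpace.mk'
      (EuclideanSpace ℝ (Fin d) →L[ℝ] EuclideanSpace ℝ (Fin d) →L[ℝ] ℝ)
      (E := fun p : M ↦ TangentSpace (𝓡 d) p →L[ℝ] TangentSpace (𝓡 d) p →L[ℝ] ℝ) p (val p))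

section LeviCivita

variable {d : ℕ} {M : Type*} [TopologicalSpace M] [ChartedSpace (EuclideanSpace ℝ (Fin d)) M]
  [IsManifold (𝓡 d) ∞ M]

/-- The vector field `Y` is differentiable at `p`. -/
abbrev DiffAt (Y : ∀ p : M, TangentSpace (𝓡 d) p) (p : M) : Prop :=
  MDifferentiableAt (𝓡 d) (𝓡 d).tangent (fun q ↦ (⟨q, Y q⟩ : TangentBundle (𝓡 d) M)) p

/-- The differential `df_p(v)` of a real function. -/
def dfun (f : M → ℝ) (p : M) (v : TangentSpace (𝓡 d) p) : ℝ :=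
  mvfderiv (𝓡 d) f p v

/-- The right-hand side of the Koszul formula at `p`:
`X g(Y,Z) + Y g(Z,X) - Z g(X,Y) + g([X,Y],Z) - g([Y,Z],X) + g([Z,X],Y)`. -/
def koszul (g : ∀ p : M, TangentSpace (𝓡 d) p → TangentSpace (𝓡 d) p → ℝ)
    (X Y Z : ∀ p : M, TangentSpace (𝓡 d) p) (p : M) : ℝ :=
  dfun (fun q ↦ g q (Y q) (Z q)) p (X p) + dfun (fun q ↦ g q (Z q) (X q)) p (Y p)
    - dfun (fun q ↦ g q (X q) (Y q)) p (Z p)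
    + g p (VectorField.mlieBracket (𝓡 d) X Y p) (Z p)
    - g p (VectorField.mlieBracket (𝓡 d) Y Z p) (X p)
    + g p (VectorField.mlieBracket (𝓡 d) Z X p) (Y p)

/-- The Levi-Civita connection `(∇_v Y)(p)` of the metric `g`: the vector `w` at `p` which satisfies
the Koszul formula `2 g(w, Z) = koszul g X Y Z` for all vector fields `X`, `Z` that are
differentiable at `p`, with `X p = v`. (For a semi-Riemannian metric `g` and a vector field `Y`
differentiable at `p`, there is exactly one such `w`, see `existsUnique_koszul`.) -/
def leviCivita (g : ∀ p : M, TangentSpace (𝓡 d) p → TangentSpace (𝓡 d) p → ℝ)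
    (Y : ∀ p : M, TangentSpace (𝓡 d) p) (p : M) (v : TangentSpace (𝓡 d) p) :
    TangentSpace (𝓡 d) p :=
  Classical.epsilon fun w ↦ ∀ X Z : ∀ q : M, TangentSpace (𝓡 d) q,
    DiffAt X p → DiffAt Z p → X p = v → 2 * g p w (Z p) = koszul g X Y Z p

set_option linter.unusedSectionVars false

lemma mdifferentiableAt_metric (g : SemiRiemannianMetric d M) {Y Z : ∀ p : M, TangentSpace (𝓡 d) p} {p : M}
  (hY : DiffAt Y p) (hZ : DiffAt Z p) :
  MDifferentiableAt (𝓡 d) 𝓘(ℝ, ℝ) (fun q ↦ g.val q (Y q) (Z q)) p := by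
  have hg := (g.contMDiff p).mdifferentiableAt (by simp)
  have := MDifferentiableAt.clm_bundle_apply₂ (F₁ := EuclideanSpace ℝ (Fin d)) (F₂ := EuclideanSpace ℝ (Fin d)) (F₃ := ℝ) (E₁ := (TangentSpace (𝓡 d) : M → Type _)) (E₂ := (TangentSpace (𝓡 d) : M → Type _)) (E₃ := Bundle.Trivial M ℝ) (b := id) hg hY hZ
  simp only [mdifferentiableAt_totalSpace] at this
  exact this.2

lemma dfun_add {f g : M → ℝ} {p : M} (hf : MDifferentiableAt (𝓡 d) 𝓘(ℝ, ℝ) f p) (hg : MDifferentiableAt (𝓡 d) 𝓘(ℝ, ℝ) g p) (v : TangentSpace (𝓡 d) p) :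
   dfun (fun q ↦ f q + g q) p v = dfun f p v + dfun g p v := by
  simp [dfun, mvfderiv_fun_add hf hg]
lemma dfun_mul {f g : M → ℝ} {p : M} (hf : MDifferentiableAt (𝓡 d) 𝓘(ℝ, ℝ) f p) (hg : MDifferentiableAt (𝓡 d) 𝓘(ℝ, ℝ) g p) (v : TangentSpace (𝓡 d) p) :
   dfun (fun q ↦ f q * g q) p v = f p * dfun g p v + g p * dfun f p v := by
  simp [dfun, mvfderiv_fun_mul hf hg]

lemma tensorialAt_koszul_left (g : SemiRiemannianMetric d M) {Y Z : ∀ p : M, TangentSpace (𝓡 d) p} {p : M}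
    (hY : DiffAt Y p) (hZ : DiffAt Z p) :
    TensorialAt (𝓡 d) (EuclideanSpace ℝ (Fin d)) (fun X ↦ koszul (fun q u v ↦ g.val q u v) X Y Z p) p where
  smul {f X} hf hX := by
    have : IsManifold (𝓡 d) (minSmoothness ℝ 2) M := by
      simp only [minSmoothness_of_isRCLikeNormedField]; infer_instance
    have h1 := dfun_mul hf (mdifferentiableAt_metric g hZ hX)
    have h2 := dfun_mul hf (mdifferentiableAt_metric g hX hY)
    simp only [koszul, Pi.smul_apply', map_smul, smul_eq_mul, smul_apply, h1, h2,
      VectorField.mlieBracket_smul_left hf hX, VectorField.mlieBracket_smul_right hf hX, map_add, add_apply, map_neg, neg_apply, neg_smul]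
    simp only [dfun, map_smul, smul_eq_mul, g.symm p (Z p) (X p)]
    ring
  add {X X'} hX hX' := by
    have : IsManifold (𝓡 d) (minSmoothness ℝ 2) M := by
      simp only [minSmoothness_of_isRCLikeNormedField]; infer_instance
    have h1 := dfun_add (mdifferentiableAt_metric g hZ hX) (mdifferentiableAt_metric g hZ hX')
    have h2 := dfun_add (mdifferentiableAt_metric g hX hY) (mdifferentiableAt_metric g hX' hY)
    simp only [koszul, Pi.add_apply, map_add, add_apply, h1, h2,
      VectorField.mlieBracket_add_left hX hX', VectorField.mlieBracket_add_right hX hX']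
    simp only [dfun, map_add]
    ring

lemma tensorialAt_koszul_right (g : SemiRiemannianMetric d M) {X Y : ∀ p : M, TangentSpace (𝓡 d) p} {p : M}
    (hX : DiffAt X p) (hY : DiffAt Y p) :
    TensorialAt (𝓡 d) (EuclideanSpace ℝ (Fin d)) (fun Z ↦ koszul (fun q u v ↦ g.val q u v) X Y Z p) p where
  smul {f Z} hf hZ := by
    have : IsManifold (𝓡 d) (minSmoothness ℝ 2) M := by
      simp only [minSmoothness_of_isRCLikeNormedField]; infer_instance
    have h1 := dfun_mul hf (mdifferentiableAt_metric g hY hZ)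
    have h2 := dfun_mul hf (mdifferentiableAt_metric g hZ hX)
    simp only [koszul, Pi.smul_apply', map_smul, smul_eq_mul, smul_apply, h1, h2,
      VectorField.mlieBracket_smul_left hf hZ, VectorField.mlieBracket_smul_right hf hZ, map_add, add_apply, map_neg, neg_apply, neg_smul]
    simp only [dfun, map_smul, smul_eq_mul, g.symm p (Z p)]
    ring
  add {Z Z'} hZ hZ' := by
    have : IsManifold (𝓡 d) (minSmoothness ℝ 2) M := by
      simp only [minSmoothness_of_isRCLikeNormedField]; infer_instance
    have h1 := dfun_add (mdifferentiableAt_metric g hY hZ) (mdifferentiableAt_metric g hY hZ')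
    have h2 := dfun_add (mdifferentiableAt_metric g hZ hX) (mdifferentiableAt_metric g hZ' hX)
    simp only [koszul, Pi.add_apply, map_add, add_apply, h1, h2,
      VectorField.mlieBracket_add_left hZ hZ', VectorField.mlieBracket_add_right hZ hZ']
    simp only [dfun, map_add]
    ring

/-- The Levi-Civita connection is well defined: exactly one vector satisfies the Koszul formula. -/
theorem existsUnique_koszul (g : SemiRiemannianMetric d M) {Y : ∀ p : M, TangentSpace (𝓡 d) p} {p : M}
    (hY : DiffAt Y p) (v : TangentSpace (𝓡 d) p) :
    ∃! w : TangentSpace (𝓡 d) p, ∀ X Z : ∀ q : M, TangentSpace (𝓡 d) q,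
      DiffAt X p → DiffAt Z p → X p = v →
        2 * g.val p w (Z p) = koszul (fun q u v ↦ g.val q u v) X Y Z p := by
  have hext (u : TangentSpace (𝓡 d) p) : DiffAt (FiberBundle.extend (EuclideanSpace ℝ (Fin d)) u) p :=
    FiberBundle.mdifferentiableAt_extend (𝓡 d) (EuclideanSpace ℝ (Fin d)) u
  let L := TensorialAt.mkHom _ p (tensorialAt_koszul_right g (hext v) hY)
  have : FiniteDimensional ℝ (TangentSpace (𝓡 d) p) := inferInstanceAs (FiniteDimensional ℝ (EuclideanSpace ℝ (Fin d)))
  let B : TangentSpace (𝓡 d) p →ₗ[ℝ] (TangentSpace (𝓡 d) p →ₗ[ℝ] ℝ) :=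
    { toFun := fun u ↦ (g.val p u).toLinearMap
      map_add' := by intros; ext; simp
      map_smul' := by intros; ext; simp }
  have hB : Function.Injective B := by
    rw [injective_iff_map_eq_zero]
    intro u hu
    exact g.nondegenerate p u fun v ↦ congrArg (fun f ↦ f v) hu
  have hB' : Function.Surjective B := by
    rw [← LinearMap.range_eq_top]
    apply Submodule.eq_top_of_finrank_eq
    rw [LinearMap.finrank_range_of_inj hB]
    exact (Subspace.dual_finrank_eq (K := ℝ) (V := TangentSpace (𝓡 d) p)).symm
  obtain ⟨w, hw⟩ := hB' ((2⁻¹ : ℝ) • L.toLinearMap)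
  have hw' (u) : 2 * g.val p w u = L u := by
    have := congrArg (fun f ↦ f u) hw
    simp [B] at this
    linarith
  refine ⟨w, fun X Z hX hZ hXv ↦ ?_, fun w' h ↦ ?_⟩
  · rw [hw']
    have h1 := TensorialAt.mkHom_apply (tensorialAt_koszul_right g (hext v) hY) hZ
    refine h1.trans ?_
    exact (tensorialAt_koszul_left g hY hZ).pointwise (hext v) hX (by simp [hXv])
  · apply hB
    ext u
    have h1 := h _ _ (hext v) (hext u) (by simp)
    have h2 := hw' u
    have h3 := TensorialAt.mkHom_apply (tensorialAt_koszul_right g (hext v) hY) (hext u)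
    simp only [FiberBundle.extend_apply_self] at h1 h3
    have : g.val p w' u = g.val p w u := by
      have : L u = _ := h3
      linarith
    exact this

end LeviCivita

section Hypersurface

variable {n : ℕ}
  {M : Type*} [TopologicalSpace M] [ChartedSpace (EuclideanSpace ℝ (Fin n)) M]
  [IsManifold (𝓡 n) ∞ M]
  {M' : Type*} [TopologicalSpace M'] [ChartedSpace (EuclideanSpace ℝ (Fin (n + 1))) M']
  [IsManifold (𝓡 (n + 1)) ∞ M']

/-- The differential `dx_p : T_pM → T_{x(p)}M'` of a map `x : M → M'`. -/
def dmap (x : M → M') (p : M) : TangentSpace (𝓡 n) p →L[ℝ] TangentSpace (𝓡 (n + 1)) (x p) :=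
  mfderiv (𝓡 n) (𝓡 (n + 1)) x p

/-- The induced (possibly degenerate) metric `g = x^* gbar` on `M`. -/
def pullbackMetric (gbar : SemiRiemannianMetric (n + 1) M') (x : M → M') (p : M)
    (u v : TangentSpace (𝓡 n) p) : ℝ :=
  gbar.val (x p) (dmap x p u) (dmap x p v)

/-- `x : M → M'` is a null hypersurface of `(M', gbar)`: an embedding of codimension one for which
the induced metric is degenerate at each point. -/
structure IsNullHypersurface (gbar : SemiRiemannianMetric (n + 1) M') (x : M → M') : Prop where
  isSmoothEmbedding : Manifold.IsSmoothEmbedding (𝓡 n) (𝓡 (n + 1)) ∞ x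
  degenerate (p : M) :
    ∃ u : TangentSpace (𝓡 n) p, u ≠ 0 ∧ ∀ v, pullbackMetric gbar x p u v = 0

/-- `N` is a null rigging for `x : M → M'`: a smooth section of `TM'` along `M` which is lightlike
and nowhere tangent to `M`. -/
structure IsNullRigging (gbar : SemiRiemannianMetric (n + 1) M') (x : M → M')
    (N : ∀ p : M, TangentSpace (𝓡 (n + 1)) (x p)) : Prop where
  contMDiff : ContMDiff (𝓡 n) (𝓡 (n + 1)).tangent ∞
    (fun p ↦ (⟨x p, N p⟩ : TangentBundle (𝓡 (n + 1)) M'))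
  transversal (p : M) : N p ∉ Set.range (dmap x p)
  null (p : M) : gbar.val (x p) (N p) (N p) = 0

/-- The one-form `η = x^* (gbar(N, ·))` on `M`. The screen distribution is its kernel. -/
def eta (gbar : SemiRiemannianMetric (n + 1) M') (x : M → M')
    (N : ∀ p : M, TangentSpace (𝓡 (n + 1)) (x p)) (p : M) (v : TangentSpace (𝓡 n) p) : ℝ :=
  gbar.val (x p) (N p) (dmap x p v)

/-- The rigged vector field `ξ`: the unique section of the radical bundle `TM^⊥ ⊂ TM` with
`gbar(ξ, N) = 1`. -/
def rigged (gbar : SemiRiemannianMetric (n + 1) M') (x : M → M')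
    (N : ∀ p : M, TangentSpace (𝓡 (n + 1)) (x p)) (p : M) : TangentSpace (𝓡 n) p :=
  Classical.epsilon fun u ↦ (∀ v, pullbackMetric gbar x p u v = 0) ∧ eta gbar x N p u = 1

/-- The component in `T_pM` of a vector `w` of `T_{x(p)}M'`, with respect to the decomposition
`T_{x(p)}M' = T_pM ⊕ span(N_p)`. -/
def tangentialPart (x : M → M') (N : ∀ p : M, TangentSpace (𝓡 (n + 1)) (x p)) (p : M)
    (w : TangentSpace (𝓡 (n + 1)) (x p)) : TangentSpace (𝓡 n) p :=
  Classical.epsilon fun u ↦ ∃ c : ℝ, w = dmap x p u + c • N p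

/-- The projection `P : TM → S(TM)` onto the screen distribution along `ξ`. -/
def screenProj (gbar : SemiRiemannianMetric (n + 1) M') (x : M → M')
    (N : ∀ p : M, TangentSpace (𝓡 (n + 1)) (x p)) (p : M) (v : TangentSpace (𝓡 n) p) :
    TangentSpace (𝓡 n) p :=
  v - eta gbar x N p v • rigged gbar x N p

/-- The coordinates of a vector field `W` along `x`, read in the trivialization of `TM'` at the
point `x p`; they are meaningful at the points `q` near `p`. -/
def coordAlong (x : M → M') (W : ∀ q : M, TangentSpace (𝓡 (n + 1)) (x q)) (p q : M) :
    EuclideanSpace ℝ (Fin (n + 1)) :=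
  (trivializationAt (EuclideanSpace ℝ (Fin (n + 1))) (TangentSpace (𝓡 (n + 1)) : M' → Type _) (x p)
    ⟨x q, W q⟩).2

/-- The covariant derivative `∇bar_v W` of a vector field `W` along `x : M → M'` in the direction
`v ∈ T_pM`, for the Levi-Civita connection `∇bar` of `gbar`. If `(E_i)` is the local frame of `TM'`
given by the trivialization at `x p` and `W = ∑ W^i (E_i ∘ x)`, then it is
`∑ dW^i(v) E_i + ∑ W^i(p) ∇bar_{dx(v)} E_i`; the field `∑ W^i(p) E_i` is `FiberBundle.extend _ (W p)`. -/
def covAlong (gbar : SemiRiemannianMetric (n + 1) M') (x : M → M')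
    (W : ∀ q : M, TangentSpace (𝓡 (n + 1)) (x q)) (p : M) (v : TangentSpace (𝓡 n) p) :
    TangentSpace (𝓡 (n + 1)) (x p) :=
  (trivializationAt (EuclideanSpace ℝ (Fin (n + 1))) (TangentSpace (𝓡 (n + 1)) : M' → Type _)
      (x p)).symm (x p) (mvfderiv (𝓡 n) (coordAlong x W p) p v)
    + leviCivita (fun q u v ↦ gbar.val q u v)
        (FiberBundle.extend (EuclideanSpace ℝ (Fin (n + 1))) (W p)) (x p) (dmap x p v)

/-- The connection `∇` induced on `M` by `∇bar` through the projection along `N`: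
`∇_v Y` is the tangential part of `∇bar_v Y`. -/
def inducedConnection (gbar : SemiRiemannianMetric (n + 1) M') (x : M → M')
    (N : ∀ p : M, TangentSpace (𝓡 (n + 1)) (x p)) (Y : ∀ p : M, TangentSpace (𝓡 n) p)
    (p : M) (v : TangentSpace (𝓡 n) p) : TangentSpace (𝓡 n) p :=
  tangentialPart x N p (covAlong gbar x (fun q ↦ dmap x q (Y q)) p v)

/-- The shape operator `A_N`: minus the tangential part of `∇bar_v N`. -/
def shapeN (gbar : SemiRiemannianMetric (n + 1) M') (x : M → M')
    (N : ∀ p : M, TangentSpace (𝓡 (n + 1)) (x p)) (p : M) (v : TangentSpace (𝓡 n) p) :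
    TangentSpace (𝓡 n) p :=
  - tangentialPart x N p (covAlong gbar x N p v)

/-- The rotation one-form `τ(v) = gbar(∇bar_v N, ξ)`. -/
def rotation (gbar : SemiRiemannianMetric (n + 1) M') (x : M → M')
    (N : ∀ p : M, TangentSpace (𝓡 (n + 1)) (x p)) (p : M) (v : TangentSpace (𝓡 n) p) : ℝ :=
  gbar.val (x p) (covAlong gbar x N p v) (dmap x p (rigged gbar x N p))

/-- The shape operator `A*_ξ` of the screen distribution: minus the screen component of `∇_v ξ`. -/
def shapeXi (gbar : SemiRiemannianMetric (n + 1) M') (x : M → M')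
    (N : ∀ p : M, TangentSpace (𝓡 (n + 1)) (x p)) (p : M) (v : TangentSpace (𝓡 n) p) :
    TangentSpace (𝓡 n) p :=
  - screenProj gbar x N p (inducedConnection gbar x N (rigged gbar x N) p v)

/-- The coincidence conditions `A*_ξ = α A_N` and `2 α τ(ξ) + dα(ξ) = 0`. -/
def CoincidenceConditions (gbar : SemiRiemannianMetric (n + 1) M') (x : M → M')
    (N : ∀ p : M, TangentSpace (𝓡 (n + 1)) (x p)) (α : M → ℝ) : Prop :=
  (∀ (p : M) (v : TangentSpace (𝓡 n) p), shapeXi gbar x N p v = α p • shapeN gbar x N p v) ∧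
  ∀ p : M, 2 * α p * rotation gbar x N p (rigged gbar x N p) + dfun α p (rigged gbar x N p) = 0

/-- The `α`-associated metric `g_α = g + α η ⊗ η` on `M`. -/
def associatedMetric (gbar : SemiRiemannianMetric (n + 1) M') (x : M → M')
    (N : ∀ p : M, TangentSpace (𝓡 (n + 1)) (x p)) (α : M → ℝ) (p : M)
    (u v : TangentSpace (𝓡 n) p) : ℝ :=
  pullbackMetric gbar x p u v + α p * (eta gbar x N p u * eta gbar x N p v)

/-- The coincidence `∇_α = ∇` of the Levi-Civita connection of `g_α` with the induced connection,
as operators on smooth vector fields. -/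
def ConnectionsCoincide (gbar : SemiRiemannianMetric (n + 1) M') (x : M → M')
    (N : ∀ p : M, TangentSpace (𝓡 (n + 1)) (x p)) (α : M → ℝ) : Prop :=
  ∀ Y : ∀ p : M, TangentSpace (𝓡 n) p, 
      ContMDiff (𝓡 n) (𝓡 n).tangent ∞ (fun q ↦ (⟨q, Y q⟩ : TangentBundle (𝓡 n) M)) →
    ∀ (p : M) (v : TangentSpace (𝓡 n) p),
      leviCivita (associatedMetric gbar x N α) Y p v = inducedConnection gbar x N Y p v

/-- `φ` is constant on each leaf of the screen distribution, that is, along each smooth curve that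
is everywhere tangent to the screen distribution `ker η`. -/
def IsConstantOnScreenLeaves (gbar : SemiRiemannianMetric (n + 1) M') (x : M → M')
    (N : ∀ p : M, TangentSpace (𝓡 (n + 1)) (x p)) (φ : M → ℝ) : Prop :=
  ∀ γ : ℝ → M, ContMDiff 𝓘(ℝ, ℝ) (𝓡 n) ∞ γ →
    (∀ t, eta gbar x N (γ t) (mfderiv 𝓘(ℝ, ℝ) (𝓡 n) γ t (1 : ℝ)) = 0) →
    ∀ s t, φ (γ s) = φ (γ t)

end Hypersurface

end NullHypersurface

end

/-! Passing from `N` to `φ N` leaves the line `span(N)`, hence the projection onto `TM` and the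
induced connection, unchanged. The one-form `η` becomes `φ η` and `ξ` becomes `φ⁻¹ ξ`, so `g +
(α/φ²) (φη) ⊗ (φη)` is the same tensor as `g_α`. The coincidence of connections therefore transfers
because both sides are literally the same objects (`associatedMetric_smul`,
`inducedConnection_smul`).

For the coincidence conditions, the Leibniz rule `covAlong_smul` gives three laws: `A_N` is
multiplied by `φ` (`shapeN_smul`), `A*_ξ` by `φ⁻¹` (`shapeXi_smul`), and `τ` gains `dφ/φ`
(`rotation_smul`). The first condition survives since `φ⁻¹ α = (α/φ²) φ`. In the second, the term
`dφ(ξ)` from `τ` cancels the one from `d(α/φ²)`, leaving `φ⁻³ (2 α τ(ξ) + dα(ξ))`.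

The analytic cost lies in applying the Leibniz rule to `φ⁻¹ ξ`: since `ξ` is only characterized
pointwise, its differentiability must be proved, and it comes from a linear system with
differentiable coefficients (`mdifferentiableAt_coordAlong_rigged`). -/

namespace NullHypersurface

set_option linter.unusedSectionVars false

/-! ### Immersions have injective differential. -/

open Manifold in
/-- The differential of an immersion between boundaryless manifolds is injective. -/
lemma injective_mfderiv_of_isImmersionAt {d e : ℕ}
    {M : Type*} [TopologicalSpace M] [ChartedSpace (EuclideanSpace ℝ (Fin d)) M]
    [IsManifold (𝓡 d) ∞ M]
    {M' : Type*} [TopologicalSpace M'] [ChartedSpace (EuclideanSpace ℝ (Fin e)) M']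
    [IsManifold (𝓡 e) ∞ M'] {f : M → M'} {p : M}
    (h : IsImmersionAt (𝓡 d) (𝓡 e) ∞ f p) :
    Function.Injective (mfderiv (𝓡 d) (𝓡 e) f p) := by
  have hdom := contMDiffOn_of_mem_maximalAtlas h.domChart_mem_maximalAtlas
  have hdom' := contMDiffOn_symm_of_mem_maximalAtlas h.domChart_mem_maximalAtlas
  have hcod := contMDiffOn_of_mem_maximalAtlas h.codChart_mem_maximalAtlas
  have hmd : h.domChart.MDifferentiable (𝓡 d) (𝓡 d) :=
    ⟨hdom.mdifferentiableOn (by simp), hdom'.mdifferentiableOn (by simp)⟩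
  have hfd : MDifferentiableAt (𝓡 d) (𝓡 e) f p := h.contMDiffAt.mdifferentiableAt (by simp)
  have hcd : MDifferentiableAt (𝓡 e) (𝓡 e) h.codChart (f p) :=
    (hcod.contMDiffAt (h.codChart.open_source.mem_nhds h.mem_codChart_source)).mdifferentiableAt
      (by simp)
  -- The local normal form of the immersion: in adapted charts `f` is this injective linear map.
  let ι : EuclideanSpace ℝ (Fin d) →L[ℝ] EuclideanSpace ℝ (Fin e) :=
    h.equiv.toContinuousLinearMap ∘L ContinuousLinearMap.inl ℝ _ _
  have hι : Function.Injective ι := fun a b hab ↦ by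
    simpa [ι] using hab
  have hloc : h.codChart ∘ f =ᶠ[𝓝 p] ι ∘ h.domChart := by
    filter_upwards [h.domChart.open_source.mem_nhds h.mem_domChart_source] with q hq
    have hy : h.domChart q ∈ (h.domChart.extend (𝓡 d)).target := by
      simpa using h.domChart.map_source hq
    have := h.writtenInCharts hy
    simpa [ι, h.domChart.left_inv hq] using this
  -- Differentiating the normal form: `ι` composed with the differential of the domain chart is
  -- injective and factors through the differential of `f`.
  have hmf := hloc.mfderiv_eq (I := 𝓡 d) (I' := 𝓡 e)
  rw [mfderiv_comp p hcd hfd,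
    mfderiv_comp p ι.differentiableAt.mdifferentiableAt
      (hmd.mdifferentiableAt h.mem_domChart_source)] at hmf
  intro a b hab
  have hab' := congrArg (fun L ↦ L a) hmf
  have hab'' := congrArg (fun L ↦ L b) hmf
  simp only [ContinuousLinearMap.comp_apply, hab] at hab' hab''
  have h3 := hab'.symm.trans hab''
  rw [mfderiv_eq_fderiv, ι.fderiv] at h3
  exact hmd.mfderiv_injective h.mem_domChart_source (hι h3)

/-! ### Homogeneity and locality of the Levi-Civita connection. -/

section Koszul

variable {d : ℕ} {M : Type*} [TopologicalSpace M] [ChartedSpace (EuclideanSpace ℝ (Fin d)) M]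
  [IsManifold (𝓡 d) ∞ M]

lemma dfun_const_mul {f : M → ℝ} {p : M} (c : ℝ)
    (hf : MDifferentiableAt (𝓡 d) 𝓘(ℝ, ℝ) f p) (v : TangentSpace (𝓡 d) p) :
    dfun (fun q ↦ c * f q) p v = c * dfun f p v := by
  rw [dfun_mul mdifferentiableAt_const hf]
  simp [dfun, mvfderiv_const]

/-- Uniqueness in the Koszul formula turns every identity for the chosen vector into a verification
of that formula. -/
lemma leviCivita_eq (g : SemiRiemannianMetric d M) {Y : ∀ p : M, TangentSpace (𝓡 d) p} {p : M}
    (hY : DiffAt Y p) {v w : TangentSpace (𝓡 d) p}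
    (hw : ∀ X Z : ∀ q : M, TangentSpace (𝓡 d) q, DiffAt X p → DiffAt Z p → X p = v →
      2 * g.val p w (Z p) = koszul (fun q u v ↦ g.val q u v) X Y Z p) :
    leviCivita (fun q u v ↦ g.val q u v) Y p v = w :=
  (existsUnique_koszul g hY v).unique
    (Classical.epsilon_spec (existsUnique_koszul g hY v).exists) hw

lemma leviCivita_spec (g : SemiRiemannianMetric d M) {Y : ∀ p : M, TangentSpace (𝓡 d) p} {p : M}
    (hY : DiffAt Y p) (v : TangentSpace (𝓡 d) p) (X Z : ∀ q : M, TangentSpace (𝓡 d) q)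
    (hX : DiffAt X p) (hZ : DiffAt Z p) (hv : X p = v) :
    2 * g.val p (leviCivita (fun q u v ↦ g.val q u v) Y p v) (Z p) =
      koszul (fun q u v ↦ g.val q u v) X Y Z p :=
  Classical.epsilon_spec (existsUnique_koszul g hY v).exists X Z hX hZ hv

/-- The Levi-Civita connection is homogeneous in the differentiated field. -/
lemma leviCivita_const_smul (g : SemiRiemannianMetric d M) {Y : ∀ p : M, TangentSpace (𝓡 d) p}
    {p : M} (hY : DiffAt Y p) (c : ℝ) (v : TangentSpace (𝓡 d) p) :
    leviCivita (fun q u v ↦ g.val q u v) (c • Y) p v =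
      c • leviCivita (fun q u v ↦ g.val q u v) Y p v := by
  have : IsManifold (𝓡 d) (minSmoothness ℝ 2) M := by
    simp only [minSmoothness_of_isRCLikeNormedField]; infer_instance
  have hcY : DiffAt (c • Y) p := by
    have := MDifferentiableAt.smul_section (mdifferentiableAt_const (c := c)) hY
    exact this
  refine leviCivita_eq g hcY fun X Z hX hZ hv ↦ ?_
  have h := leviCivita_spec g hY v X Z hX hZ hv
  have h1 := dfun_const_mul c (mdifferentiableAt_metric g hY hZ) (X p)
  have h2 := dfun_const_mul c (mdifferentiableAt_metric g hX hY) (Z p)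
  simp only [koszul, Pi.smul_apply, map_smul, smul_eq_mul, smul_apply, h1, h2,
    VectorField.mlieBracket_const_smul_left hY, VectorField.mlieBracket_const_smul_right hY] at h ⊢
  simp only [dfun, map_smul, smul_eq_mul] at h ⊢
  linear_combination c * h

/-- The Levi-Civita connection is homogeneous in the direction. -/
lemma leviCivita_smul_direction (g : SemiRiemannianMetric d M)
    {Y : ∀ p : M, TangentSpace (𝓡 d) p} {p : M} (hY : DiffAt Y p) (c : ℝ)
    (v : TangentSpace (𝓡 d) p) :
    leviCivita (fun q u v ↦ g.val q u v) Y p (c • v) =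
      c • leviCivita (fun q u v ↦ g.val q u v) Y p v := by
  refine leviCivita_eq g hY fun X Z hX hZ hv ↦ ?_
  have hv' : DiffAt (FiberBundle.extend (EuclideanSpace ℝ (Fin d)) v) p :=
    FiberBundle.mdifferentiableAt_extend (𝓡 d) (EuclideanSpace ℝ (Fin d)) v
  have hT := tensorialAt_koszul_left g hY hZ
  have h1 := hT.smul (f := fun _ ↦ c) mdifferentiableAt_const hv'
  have hc : DiffAt ((fun _ : M ↦ c) • FiberBundle.extend (EuclideanSpace ℝ (Fin d)) v) p :=
    MDifferentiableAt.smul_section (mdifferentiableAt_const (c := c)) hv'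
  -- The Koszul expression sees `X` only through `X p`, so `X` may be replaced by `c` times an
  -- extension of `v`.
  have h2 := hT.pointwise hX hc (by simp [hv])
  have h3 := leviCivita_spec g hY v _ Z hv' hZ (by simp)
  rw [h2, h1, ← h3, map_smul, smul_apply, smul_eq_mul, smul_eq_mul]
  ring

lemma dfun_congr {f f' : M → ℝ} {p : M} (h : f' =ᶠ[𝓝 p] f) : dfun (d := d) f' p = dfun f p := by
  ext v
  simp only [dfun, mvfderiv, ContinuousLinearMap.comp_apply, h.mfderiv_eq]
  rfl

/-- The Levi-Civita connection depends only on the germ of the differentiated field. -/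
lemma leviCivita_congr (g : ∀ p : M, TangentSpace (𝓡 d) p → TangentSpace (𝓡 d) p → ℝ)
    {Y Y' : ∀ p : M, TangentSpace (𝓡 d) p} {p : M} (h : ∀ᶠ q in 𝓝 p, Y' q = Y q)
    (v : TangentSpace (𝓡 d) p) : leviCivita g Y' p v = leviCivita g Y p v := by
  have hk (X Z : ∀ q : M, TangentSpace (𝓡 d) q) : koszul g X Y' Z p = koszul g X Y Z p := by
    have h1 : (fun q ↦ g q (Y' q) (Z q)) =ᶠ[𝓝 p] fun q ↦ g q (Y q) (Z q) := by
      filter_upwards [h] with q hq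
      rw [hq]
    have h2 : (fun q ↦ g q (X q) (Y' q)) =ᶠ[𝓝 p] fun q ↦ g q (X q) (Y q) := by
      filter_upwards [h] with q hq
      rw [hq]
    have hX : X =ᶠ[𝓝 p] X := Filter.EventuallyEq.rfl
    have hZ : Z =ᶠ[𝓝 p] Z := Filter.EventuallyEq.rfl
    have h3 : VectorField.mlieBracket (𝓡 d) X Y' p = VectorField.mlieBracket (𝓡 d) X Y p :=
      hX.mlieBracket_vectorField_eq h
    have h4 : VectorField.mlieBracket (𝓡 d) Y' Z p = VectorField.mlieBracket (𝓡 d) Y Z p :=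
      Filter.EventuallyEq.mlieBracket_vectorField_eq h hZ
    simp only [koszul, dfun_congr h1, dfun_congr h2, h3, h4, h.self_of_nhds]
  simp only [leviCivita, hk]

end Koszul


/-! ### The splitting along the rigging, and the algebraic effect of rescaling it. -/

section Hypersurface

variable {n : ℕ}
  {M : Type*} [TopologicalSpace M] [ChartedSpace (EuclideanSpace ℝ (Fin n)) M]
  [IsManifold (𝓡 n) ∞ M]
  {M' : Type*} [TopologicalSpace M'] [ChartedSpace (EuclideanSpace ℝ (Fin (n + 1))) M']
  [IsManifold (𝓡 (n + 1)) ∞ M']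
  {gbar : SemiRiemannianMetric (n + 1) M'} {x : M → M'}
  {N : ∀ p : M, TangentSpace (𝓡 (n + 1)) (x p)} {p : M}

lemma IsNullHypersurface.contMDiff (hx : IsNullHypersurface gbar x) :
    ContMDiff (𝓡 n) (𝓡 (n + 1)) ∞ x :=
  hx.isSmoothEmbedding.contMDiff

lemma IsNullHypersurface.injective_dmap (hx : IsNullHypersurface gbar x) (p : M) :
    Function.Injective (dmap (n := n) x p) :=
  injective_mfderiv_of_isImmersionAt (hx.isSmoothEmbedding.isImmersion.isImmersionAt p)

/-- The decomposition `T_{x(p)}M' = T_pM ⊕ span(N_p)`. -/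
lemma exists_eq_dmap_add_smul (hx : IsNullHypersurface gbar x) (hN : IsNullRigging gbar x N)
    (w : TangentSpace (𝓡 (n + 1)) (x p)) :
    ∃ u : TangentSpace (𝓡 n) p, ∃ c : ℝ, w = dmap x p u + c • N p := by
  have : FiniteDimensional ℝ (TangentSpace (𝓡 (n + 1)) (x p)) :=
    inferInstanceAs (FiniteDimensional ℝ (EuclideanSpace ℝ (Fin (n + 1))))
  have : FiniteDimensional ℝ (TangentSpace (𝓡 n) p) :=
    inferInstanceAs (FiniteDimensional ℝ (EuclideanSpace ℝ (Fin n)))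
  -- Injectivity of this map is transversality of `N` together with injectivity of `dx`;
  -- surjectivity then follows by counting dimensions.
  let L : TangentSpace (𝓡 n) p × ℝ →ₗ[ℝ] TangentSpace (𝓡 (n + 1)) (x p) :=
    (dmap x p).toLinearMap.coprod (LinearMap.toSpanSingleton ℝ _ (N p))
  have hL : Function.Injective L := by
    rw [injective_iff_map_eq_zero]
    rintro ⟨u, c⟩ h
    have h' : dmap x p u + c • N p = 0 := by simpa [L] using h
    have hc : c = 0 := by
      by_contra hc
      refine hN.transversal p ⟨-c⁻¹ • u, ?_⟩
      rw [map_smul, eq_neg_of_add_eq_zero_left h', smul_neg, neg_smul, neg_neg, smul_smul,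
        inv_mul_cancel₀ hc, one_smul]
    subst hc
    have : dmap x p u = dmap x p 0 := by simpa using h'
    simp [hx.injective_dmap p this]
  have hdim : Module.finrank ℝ (TangentSpace (𝓡 n) p × ℝ) =
      Module.finrank ℝ (TangentSpace (𝓡 (n + 1)) (x p)) := by
    have h1 : Module.finrank ℝ (TangentSpace (𝓡 n) p) = n :=
      finrank_euclideanSpace_fin (𝕜 := ℝ) (n := n)
    have h2 : Module.finrank ℝ (TangentSpace (𝓡 (n + 1)) (x p)) = n + 1 :=
      finrank_euclideanSpace_fin (𝕜 := ℝ) (n := n + 1)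
    rw [Module.finrank_prod, h1, h2, Module.finrank_self]
  obtain ⟨⟨u, c⟩, h⟩ := (LinearMap.injective_iff_surjective_of_finrank_eq_finrank hdim).1 hL w
  exact ⟨u, c, by simpa [L] using h.symm⟩

lemma dmap_add_smul_inj (hx : IsNullHypersurface gbar x) (hN : IsNullRigging gbar x N)
    {u u' : TangentSpace (𝓡 n) p} {c c' : ℝ}
    (h : dmap x p u + c • N p = dmap x p u' + c' • N p) : u = u' := by
  have h' : dmap x p (u - u') = (c' - c) • N p := by
    rw [map_sub, sub_smul, sub_eq_sub_iff_add_eq_add, h]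
    exact _root_.add_comm _ _
  by_cases hc : c' - c = 0
  · rw [hc, zero_smul, ← map_zero (dmap x p)] at h'
    exact sub_eq_zero.1 (hx.injective_dmap p h')
  · refine absurd ⟨(c' - c)⁻¹ • (u - u'), ?_⟩ (hN.transversal p)
    rw [map_smul, h', smul_smul, inv_mul_cancel₀ hc, one_smul]

lemma tangentialPart_eq (hx : IsNullHypersurface gbar x) (hN : IsNullRigging gbar x N)
    (u : TangentSpace (𝓡 n) p) (c : ℝ) :
    tangentialPart x N p (dmap x p u + c • N p) = u := by
  obtain ⟨c', h⟩ := Classical.epsilon_spec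
    (p := fun u' ↦ ∃ c' : ℝ, dmap x p u + c • N p = dmap x p u' + c' • N p) ⟨u, c, rfl⟩
  exact (dmap_add_smul_inj hx hN h).symm

/-- Shaped after the output of the Leibniz rule: the derivative of the scalar contributes a multiple
of `N` when the field is `N` (`u = 0`), and a tangent vector when it is `dx(ξ)` (`b = 0`). -/
lemma tangentialPart_smul_add (hx : IsNullHypersurface gbar x) (hN : IsNullRigging gbar x N)
    (a b : ℝ) (u : TangentSpace (𝓡 n) p) (w : TangentSpace (𝓡 (n + 1)) (x p)) :
    tangentialPart x N p (dmap x p u + b • N p + a • w) = u + a • tangentialPart x N p w := by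
  obtain ⟨u', c, rfl⟩ := exists_eq_dmap_add_smul hx hN w
  rw [tangentialPart_eq hx hN, ← tangentialPart_eq hx hN (u + a • u') (b + a * c)]
  congr 1
  rw [map_add, map_smul]
  module

/-- Rescaling the rigging does not change the projection to `TM`. -/
lemma tangentialPart_smul {φ : M → ℝ} (hφ : ∀ p, φ p ≠ 0) (p : M)
    (w : TangentSpace (𝓡 (n + 1)) (x p)) :
    tangentialPart x (fun p ↦ φ p • N p) p w = tangentialPart x N p w := by
  unfold tangentialPart
  congr 1
  ext u
  constructor
  · rintro ⟨c, h⟩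
    exact ⟨c * φ p, by rw [h, smul_smul]⟩
  · rintro ⟨c, h⟩
    exact ⟨c / φ p, by rw [h, smul_smul, div_mul_cancel₀ _ (hφ p)]⟩

/-- The rigging enters only through the projection, which depends on the line it spans. -/
lemma inducedConnection_smul {φ : M → ℝ} (hφ : ∀ p, φ p ≠ 0) :
    inducedConnection gbar x (fun p ↦ φ p • N p) = inducedConnection gbar x N := by
  ext Y p v : 3
  exact tangentialPart_smul hφ p _

lemma eta_smul (φ : M → ℝ) (p : M) (v : TangentSpace (𝓡 n) p) :
    eta gbar x (fun p ↦ φ p • N p) p v = φ p * eta gbar x N p v := by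
  simp [eta]

/-- The two factors `φ` produced by `η ⊗ η` cancel the division by `φ²`. -/
lemma associatedMetric_smul {φ : M → ℝ} (hφ : ∀ p, φ p ≠ 0) (α : M → ℝ) :
    associatedMetric gbar x (fun p ↦ φ p • N p) (fun p ↦ α p / φ p ^ 2) =
      associatedMetric gbar x N α := by
  ext p u v
  have := hφ p
  simp only [associatedMetric, eta_smul]
  field_simp

/-- A vector at `x p` that is orthogonal to `TM` and to `N` vanishes. -/
lemma eq_zero_of_orthogonal (hx : IsNullHypersurface gbar x) (hN : IsNullRigging gbar x N)
    {w : TangentSpace (𝓡 (n + 1)) (x p)} (h : ∀ v, gbar.val (x p) w (dmap x p v) = 0)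
    (h' : gbar.val (x p) w (N p) = 0) : w = 0 := by
  refine gbar.nondegenerate (x p) w fun z ↦ ?_
  obtain ⟨u, c, rfl⟩ := exists_eq_dmap_add_smul hx hN z
  rw [map_add, map_smul, h, h', smul_zero, add_zero]

/-- The difference of two candidates is orthogonal to `TM`, both being radical, and to `N`, both
pairing to 1 with it. -/
lemma rigged_unique (hx : IsNullHypersurface gbar x) (hN : IsNullRigging gbar x N)
    {u u' : TangentSpace (𝓡 n) p}
    (h : ∀ v, pullbackMetric gbar x p u v = 0) (h1 : eta gbar x N p u = 1)
    (h' : ∀ v, pullbackMetric gbar x p u' v = 0) (h1' : eta gbar x N p u' = 1) : u = u' := by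
  apply hx.injective_dmap p
  rw [← sub_eq_zero]
  refine eq_zero_of_orthogonal hx hN (fun v ↦ ?_) ?_
  · have a := h v
    have b := h' v
    unfold pullbackMetric at a b
    simp [a, b]
  · unfold eta at h1 h1'
    rw [gbar.symm, map_sub, h1, h1', sub_self]

lemma rigged_exists (hx : IsNullHypersurface gbar x) (hN : IsNullRigging gbar x N) (p : M) :
    ∃ u, (∀ v, pullbackMetric gbar x p u v = 0) ∧ eta gbar x N p u = 1 := by
  obtain ⟨u, hu0, hu⟩ := hx.degenerate p
  -- A radical vector with `η(u) = 0` would be orthogonal to all of `TM'`; so any nonzero radical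
  -- vector can be normalized.
  have hη : eta gbar x N p u ≠ 0 := fun h ↦ hu0 <| hx.injective_dmap p <| by
    rw [map_zero]
    exact eq_zero_of_orthogonal hx hN hu (by rw [gbar.symm]; exact h)
  refine ⟨(eta gbar x N p u)⁻¹ • u, fun v ↦ ?_, ?_⟩
  · have := hu v
    unfold pullbackMetric at this ⊢
    rw [map_smul, map_smul, smul_apply, this, smul_zero]
  · have : eta gbar x N p ((eta gbar x N p u)⁻¹ • u) =
        (eta gbar x N p u)⁻¹ * eta gbar x N p u := by simp [eta]
    rw [this, inv_mul_cancel₀ hη]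

lemma rigged_spec (hx : IsNullHypersurface gbar x) (hN : IsNullRigging gbar x N) (p : M) :
    (∀ v, pullbackMetric gbar x p (rigged gbar x N p) v = 0) ∧
      eta gbar x N p (rigged gbar x N p) = 1 :=
  Classical.epsilon_spec (rigged_exists hx hN p)

/-- The rigged field of `φ N` is `φ⁻¹ ξ`. -/
lemma rigged_smul (hx : IsNullHypersurface gbar x) (hN : IsNullRigging gbar x N) {φ : M → ℝ}
    (hN' : IsNullRigging gbar x (fun p ↦ φ p • N p)) (hφ : ∀ p, φ p ≠ 0) (p : M) :
    rigged gbar x (fun p ↦ φ p • N p) p = (φ p)⁻¹ • rigged gbar x N p := by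
  obtain ⟨h, h1⟩ := rigged_spec hx hN p
  obtain ⟨h', h1'⟩ := rigged_spec hx hN' p
  refine rigged_unique hx hN' h' h1' (fun v ↦ ?_) ?_
  · have := h v
    unfold pullbackMetric at this ⊢
    rw [map_smul, map_smul, smul_apply, this, smul_zero]
  · rw [eta_smul]
    unfold eta at h1 ⊢
    rw [map_smul, map_smul, h1, smul_eq_mul, mul_one, mul_inv_cancel₀ (hφ p)]

lemma screenProj_smul (hx : IsNullHypersurface gbar x) (hN : IsNullRigging gbar x N) {φ : M → ℝ}
    (hN' : IsNullRigging gbar x (fun p ↦ φ p • N p)) (hφ : ∀ p, φ p ≠ 0) (p : M)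
    (v : TangentSpace (𝓡 n) p) :
    screenProj gbar x (fun p ↦ φ p • N p) p v = screenProj gbar x N p v := by
  rw [screenProj, screenProj, rigged_smul hx hN hN' hφ, eta_smul, smul_smul, mul_right_comm,
    mul_inv_cancel₀ (hφ p), one_mul]

/-- Because `η(ξ) = 1`, multiples of `ξ` are killed. This discards the derivative of `φ⁻¹` in `∇(φ⁻¹
ξ)`. -/
lemma screenProj_smul_rigged_add (hx : IsNullHypersurface gbar x) (hN : IsNullRigging gbar x N)
    (a b : ℝ) (v : TangentSpace (𝓡 n) p) :
    screenProj gbar x N p (a • rigged gbar x N p + b • v) = b • screenProj gbar x N p v := by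
  have h1 := (rigged_spec hx hN p).2
  have h2 : eta gbar x N p (a • rigged gbar x N p + b • v) =
      a * eta gbar x N p (rigged gbar x N p) + b * eta gbar x N p v := by
    simp [eta]
  rw [screenProj, screenProj, h2, h1]
  module

/-! ### Covariant differentiation along the hypersurface. -/

lemma eventually_mem_baseSet (hx : ContinuousAt x p) :
    ∀ᶠ q in 𝓝 p, x q ∈ (trivializationAt (EuclideanSpace ℝ (Fin (n + 1)))
      (TangentSpace (𝓡 (n + 1)) : M' → Type _) (x p)).baseSet :=
  hx.eventually_mem ((trivializationAt (EuclideanSpace ℝ (Fin (n + 1)))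
    (TangentSpace (𝓡 (n + 1)) : M' → Type _) (x p)).open_baseSet.mem_nhds
      (FiberBundle.mem_baseSet_trivializationAt' (x p)))

lemma coordAlong_smul_eventuallyEq (hx : ContinuousAt x p) (f : M → ℝ)
    (W : ∀ q : M, TangentSpace (𝓡 (n + 1)) (x q)) :
    coordAlong (n := n) x (fun q ↦ f q • W q) p =ᶠ[𝓝 p] fun q ↦ f q • coordAlong x W p q := by
  filter_upwards [eventually_mem_baseSet (n := n) hx] with q hq
  exact ((trivializationAt (EuclideanSpace ℝ (Fin (n + 1)))
    (TangentSpace (𝓡 (n + 1)) : M' → Type _) (x p)).linear ℝ hq).map_smul (f q) (W q)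

/-- Trivializations are fibrewise linear over the base set. Equality near `b` suffices, as the
Levi-Civita connection depends only on germs. -/
lemma extend_smul_eventually {b : M'} (c : ℝ) (w : TangentSpace (𝓡 (n + 1)) b) :
    ∀ᶠ y in 𝓝 b, FiberBundle.extend (EuclideanSpace ℝ (Fin (n + 1))) (c • w) y =
      (c • FiberBundle.extend (EuclideanSpace ℝ (Fin (n + 1))) w) y := by
  have hb := FiberBundle.mem_baseSet_trivializationAt' (F := EuclideanSpace ℝ (Fin (n + 1)))
    (E := (TangentSpace (𝓡 (n + 1)) : M' → Type _)) b
  have h1 : (trivializationAt (EuclideanSpace ℝ (Fin (n + 1)))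
      (TangentSpace (𝓡 (n + 1)) : M' → Type _) b ⟨b, c • w⟩).2 =
      c • (trivializationAt (EuclideanSpace ℝ (Fin (n + 1)))
      (TangentSpace (𝓡 (n + 1)) : M' → Type _) b ⟨b, w⟩).2 :=
    ((trivializationAt (EuclideanSpace ℝ (Fin (n + 1)))
      (TangentSpace (𝓡 (n + 1)) : M' → Type _) b).linear ℝ hb).map_smul c w
  filter_upwards [(trivializationAt (EuclideanSpace ℝ (Fin (n + 1)))
      (TangentSpace (𝓡 (n + 1)) : M' → Type _) b).open_baseSet.mem_nhds hb] with y hy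
  simp only [FiberBundle.extend, Pi.smul_apply, h1]
  rw [← Trivialization.coe_symmₗ (R := ℝ) _ hy, map_smul]

/-- The Leibniz rule for the covariant derivative along `x`. -/
lemma covAlong_smul (hx : ContinuousAt x p) {f : M → ℝ}
    (hf : MDifferentiableAt (𝓡 n) 𝓘(ℝ, ℝ) f p) {W : ∀ q : M, TangentSpace (𝓡 (n + 1)) (x q)}
    (hW : MDifferentiableAt (𝓡 n) 𝓘(ℝ, EuclideanSpace ℝ (Fin (n + 1))) (coordAlong x W p) p)
    (v : TangentSpace (𝓡 n) p) :
    covAlong gbar x (fun q ↦ f q • W q) p v =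
      dfun f p v • W p + f p • covAlong gbar x W p v := by
  have hb := FiberBundle.mem_baseSet_trivializationAt' (F := EuclideanSpace ℝ (Fin (n + 1)))
    (E := (TangentSpace (𝓡 (n + 1)) : M' → Type _)) (x p)
  have hd : mvfderiv (𝓡 n) (coordAlong x (fun q ↦ f q • W q) p) p v =
      f p • mvfderiv (𝓡 n) (coordAlong x W p) p v + dfun f p v • coordAlong x W p p := by
    have h1 : mvfderiv (𝓡 n) (coordAlong x (fun q ↦ f q • W q) p) p v =
        mvfderiv (𝓡 n) (fun q ↦ f q • coordAlong x W p q) p v := by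
      have h := coordAlong_smul_eventuallyEq hx f W
      simp only [mvfderiv, ContinuousLinearMap.comp_apply, h.mfderiv_eq]
      rfl
    rw [h1, mvfderiv_fun_smul hf hW]
    rfl
  have hc : (trivializationAt (EuclideanSpace ℝ (Fin (n + 1)))
      (TangentSpace (𝓡 (n + 1)) : M' → Type _) (x p)).symm (x p) (coordAlong x W p p) = W p :=
    Trivialization.symm_apply_apply_mk _ hb (W p)
  have hL := leviCivita_const_smul gbar (FiberBundle.mdifferentiableAt_extend (𝓡 (n + 1))
    (EuclideanSpace ℝ (Fin (n + 1))) (W p)) (f p) (dmap x p v)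
  rw [covAlong, hd, leviCivita_congr _ (extend_smul_eventually (f p) (W p)), hL, covAlong, ← Trivialization.coe_symmₗ (R := ℝ) _ hb, map_add,
    map_smul, map_smul, Trivialization.coe_symmₗ (R := ℝ) _ hb, hc]
  module

/-- A section of `TM'` along `x` is differentiable if and only if its coordinates are. -/
lemma mdifferentiableAt_along_iff {W : ∀ q : M, TangentSpace (𝓡 (n + 1)) (x q)} :
    MDifferentiableAt (𝓡 n) (𝓡 (n + 1)).tangent
      (fun q ↦ (⟨x q, W q⟩ : TangentBundle (𝓡 (n + 1)) M')) p ↔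
    MDifferentiableAt (𝓡 n) (𝓡 (n + 1)) x p ∧
      MDifferentiableAt (𝓡 n) 𝓘(ℝ, EuclideanSpace ℝ (Fin (n + 1))) (coordAlong x W p) p :=
  mdifferentiableAt_totalSpace (IM := 𝓡 n) (IB := 𝓡 (n + 1))
    (E := (TangentSpace (𝓡 (n + 1)) : M' → Type _)) _

lemma isNullRigging_smul (hN : IsNullRigging gbar x N) {φ : M → ℝ}
    (hφ : ContMDiff (𝓡 n) 𝓘(ℝ, ℝ) ∞ φ) (hφ_ne : ∀ p, φ p ≠ 0) :
    IsNullRigging gbar x (fun p ↦ φ p • N p) where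
  contMDiff p := by
    have h := (contMDiffAt_totalSpace (IM := 𝓡 n) (IB := 𝓡 (n + 1))
      (E := (TangentSpace (𝓡 (n + 1)) : M' → Type _))).1 (hN.contMDiff p)
    refine (contMDiffAt_totalSpace (IM := 𝓡 n) (IB := 𝓡 (n + 1))
      (E := (TangentSpace (𝓡 (n + 1)) : M' → Type _))).2 ⟨h.1, ?_⟩
    exact ((hφ p).smul h.2).congr_of_eventuallyEq
      (coordAlong_smul_eventuallyEq h.1.continuousAt φ N)
  transversal p := by
    rintro ⟨u, hu⟩
    refine hN.transversal p ⟨(φ p)⁻¹ • u, ?_⟩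
    rw [map_smul, hu, smul_smul, inv_mul_cancel₀ (hφ_ne p), one_smul]
  null p := by simp [hN.null p]

/-! ### Differentiability of the rigged field. -/

lemma mdifferentiableAt_metric_along (gbar : SemiRiemannianMetric (n + 1) M')
    {V W : ∀ q : M, TangentSpace (𝓡 (n + 1)) (x q)}
    (hV : MDifferentiableAt (𝓡 n) (𝓡 (n + 1)).tangent
      (fun q ↦ (⟨x q, V q⟩ : TangentBundle (𝓡 (n + 1)) M')) p)
    (hW : MDifferentiableAt (𝓡 n) (𝓡 (n + 1)).tangent
      (fun q ↦ (⟨x q, W q⟩ : TangentBundle (𝓡 (n + 1)) M')) p) :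
    MDifferentiableAt (𝓡 n) 𝓘(ℝ, ℝ) (fun q ↦ gbar.val (x q) (V q) (W q)) p := by
  have hx := (mdifferentiableAt_along_iff.1 hV).1
  have hg := ((gbar.contMDiff (x p)).mdifferentiableAt (by simp)).comp p hx
  have := MDifferentiableAt.clm_bundle_apply₂ (F₁ := EuclideanSpace ℝ (Fin (n + 1)))
    (F₂ := EuclideanSpace ℝ (Fin (n + 1))) (F₃ := ℝ)
    (E₁ := (TangentSpace (𝓡 (n + 1)) : M' → Type _))
    (E₂ := (TangentSpace (𝓡 (n + 1)) : M' → Type _)) (E₃ := Bundle.Trivial M' ℝ)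
    (b := x) hg hV hW
  simp only [mdifferentiableAt_totalSpace] at this
  exact this.2

lemma mdifferentiableAt_dmap (hx : ContMDiff (𝓡 n) (𝓡 (n + 1)) ∞ x)
    {Y : ∀ q : M, TangentSpace (𝓡 n) q} (hY : DiffAt Y p) :
    MDifferentiableAt (𝓡 n) (𝓡 (n + 1)).tangent
      (fun q ↦ (⟨x q, dmap x q (Y q)⟩ : TangentBundle (𝓡 (n + 1)) M')) p :=
  ((hx.contMDiff_tangentMap (m := 1) (by norm_cast)).contMDiffAt.mdifferentiableAt
    (by simp)).comp p hY

/-- The solution of a linear system depends differentiably on its coefficients. -/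
lemma mdifferentiableAt_of_linear_system {E F : Type*} [NormedAddCommGroup E] [NormedSpace ℝ E]
    [FiniteDimensional ℝ E] [NormedAddCommGroup F] [NormedSpace ℝ F] [FiniteDimensional ℝ F]
    (hEF : Module.finrank ℝ E = Module.finrank ℝ F) {A : M → E →L[ℝ] F} {c : M → E} {b : F}
    (hA : MDifferentiableAt (𝓡 n) 𝓘(ℝ, E →L[ℝ] F) A p) (hinj : Function.Injective (A p))
    (hc : ∀ᶠ q in 𝓝 p, A q (c q) = b) : MDifferentiableAt (𝓡 n) 𝓘(ℝ, E) c p := by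
  have : CompleteSpace E := FiniteDimensional.complete ℝ E
  let e : E ≃L[ℝ] F :=
    (LinearEquiv.ofInjectiveOfFinrankEq (A p).toLinearMap hinj hEF).toContinuousLinearEquiv
  have he : (e : E →L[ℝ] F) = A p := by ext; rfl
  have hinv : MDifferentiableAt (𝓡 n) 𝓘(ℝ, F →L[ℝ] E) (fun q ↦ (A q).inverse) p := by
    have h := (contDiffAt_map_inverse (𝕜 := ℝ) (n := 1) e).differentiableAt (by simp)
    rw [he] at h
    exact h.mdifferentiableAt.comp p hA
  -- Invertible operators form an open set, so injectivity at `p` alone makes `c q = (A q)⁻¹ b` near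
  -- `p`.
  have hnhds : ∀ᶠ q in 𝓝 p, A q ∈ Set.range ((↑) : (E ≃L[ℝ] F) → E →L[ℝ] F) :=
    hA.continuousAt.eventually_mem (he ▸ e.nhds)
  refine (hinv.clm_apply (mdifferentiableAt_const (c := b))).congr_of_eventuallyEq ?_
  filter_upwards [hc, hnhds] with q hq hq'
  obtain ⟨e', he'⟩ := hq'
  rw [← hq, ← he']
  simp

lemma mdifferentiableAt_pi {ι : Type*} [Fintype ι] {F : Type*} [NormedAddCommGroup F]
    [NormedSpace ℝ F] {f : M → ι → F}
    (h : ∀ i, MDifferentiableAt (𝓡 n) 𝓘(ℝ, F) (fun q ↦ f q i) p) :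
    MDifferentiableAt (𝓡 n) 𝓘(ℝ, ι → F) f p := by
  rw [mdifferentiableAt_iff]
  exact ⟨continuousAt_pi.2 fun i ↦ (h i).continuousAt,
    differentiableWithinAt_pi.2 fun i ↦ ((mdifferentiableAt_iff _ _).1 (h i)).2⟩

lemma mdifferentiableAt_clm_of_apply_basis {ι κ E : Type*} [Fintype ι] [Fintype κ]
    [NormedAddCommGroup E] [NormedSpace ℝ E] [FiniteDimensional ℝ E] (b : Module.Basis ι ℝ E)
    {A : M → E →L[ℝ] (κ → ℝ)}
    (h : ∀ i k, MDifferentiableAt (𝓡 n) 𝓘(ℝ, ℝ) (fun q ↦ A q (b i) k) p) :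
    MDifferentiableAt (𝓡 n) 𝓘(ℝ, E →L[ℝ] (κ → ℝ)) A p := by
  -- An operator is a fixed continuous linear function of its values on a basis, so
  -- differentiability can be checked entrywise.
  let Ψ : (ι → κ → ℝ) →L[ℝ] E →L[ℝ] (κ → ℝ) := LinearMap.toContinuousLinearMap
    (LinearMap.toContinuousLinearMap.toLinearMap ∘ₗ (b.constr ℝ).toLinearMap)
  have hA : A = Ψ ∘ fun q i ↦ A q (b i) := by
    ext1 q
    exact ContinuousLinearMap.coe_injective
      (b.ext fun i ↦ (b.constr_basis ℝ (fun i ↦ A q (b i)) i).symm)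
  rw [hA]
  exact Ψ.differentiableAt.mdifferentiableAt.comp p
    (mdifferentiableAt_pi fun i ↦ mdifferentiableAt_pi fun k ↦ h i k)

/-- The vector field `dx(ξ)` along `x` is differentiable. -/
lemma mdifferentiableAt_coordAlong_rigged (hx : IsNullHypersurface gbar x)
    (hN : IsNullRigging gbar x N) (p : M) :
    MDifferentiableAt (𝓡 n) 𝓘(ℝ, EuclideanSpace ℝ (Fin (n + 1)))
      (coordAlong x (fun q ↦ dmap x q (rigged gbar x N q)) p) p := by
  have hxd : MDifferentiableAt (𝓡 n) (𝓡 (n + 1)) x p := (hx.contMDiff p).mdifferentiableAt (by simp)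
  set t := trivializationAt (EuclideanSpace ℝ (Fin (n + 1)))
    (TangentSpace (𝓡 (n + 1)) : M' → Type _) (x p) with ht
  have hb : x p ∈ t.baseSet := FiberBundle.mem_baseSet_trivializationAt' (x p)
  have hbase : ∀ᶠ q in 𝓝 p, x q ∈ t.baseSet :=
    eventually_mem_baseSet (n := n) hxd.continuousAt
  let b : Module.Basis (Fin n) ℝ (TangentSpace (𝓡 n) p) :=
    (EuclideanSpace.basisFun (Fin n) ℝ).toBasis
  let e (j : Fin n) (q : M) : TangentSpace (𝓡 n) q :=
    FiberBundle.extend (EuclideanSpace ℝ (Fin n)) (b j) q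
  -- Fields along `x` forming a frame at `p`: `none` indexes `N`, and `some j` the image of a local
  -- field extending the `j`-th basis vector.
  let F (k : Option (Fin n)) (q : M) : TangentSpace (𝓡 (n + 1)) (x q) :=
    k.elim (N q) fun j ↦ dmap x q (e j q)
  have hF (k : Option (Fin n)) : MDifferentiableAt (𝓡 n) (𝓡 (n + 1)).tangent
      (fun q ↦ (⟨x q, F k q⟩ : TangentBundle (𝓡 (n + 1)) M')) p := by
    cases k with
    | none => exact (hN.contMDiff p).mdifferentiableAt (by simp)
    | some j =>
      exact mdifferentiableAt_dmap hx.contMDiff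
        (FiberBundle.mdifferentiableAt_extend (𝓡 n) (EuclideanSpace ℝ (Fin n)) (b j))
  let A (q : M) : EuclideanSpace ℝ (Fin (n + 1)) →L[ℝ] (Option (Fin n) → ℝ) :=
    ContinuousLinearMap.pi fun k ↦ gbar.val (x q) (F k q) ∘L t.symmL ℝ (x q)
  -- The system characterizing `dx(ξ)`: its product with `N` is 1 and with each `dx(e_j)` is 0.
  -- Nondegeneracy of `gbar` gives injectivity at `p`.
  refine mdifferentiableAt_of_linear_system (A := A) (b := Pi.single none 1) (by simp) ?_ ?_ ?_
  · refine mdifferentiableAt_clm_of_apply_basis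
      (EuclideanSpace.basisFun (Fin (n + 1)) ℝ).toBasis fun i k ↦ ?_
    refine mdifferentiableAt_metric_along gbar (hF k) (mdifferentiableAt_along_iff.2 ⟨hxd, ?_⟩)
    have hconst := mdifferentiableAt_const (I := 𝓡 n) (x := p)
      (I' := 𝓘(ℝ, EuclideanSpace ℝ (Fin (n + 1))))
      (c := (EuclideanSpace.basisFun (Fin (n + 1)) ℝ).toBasis i)
    refine hconst.congr_of_eventuallyEq ?_
    filter_upwards [hbase] with q hq
    simp only [coordAlong, ← ht]
    have hs := t.symmL_apply (R := ℝ) hq ((EuclideanSpace.basisFun (Fin (n + 1)) ℝ).toBasis i)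
    exact (congrArg (fun w ↦ (t ⟨x q, w⟩).2) hs).trans (congrArg Prod.snd (t.apply_mk_symm hq _))
  · rw [injective_iff_map_eq_zero]
    intro a ha
    have hk (k : Option (Fin n)) : gbar.val (x p) (F k p) (t.symmL ℝ (x p) a) = 0 :=
      congrFun ha k
    have hw : t.symmL ℝ (x p) a = 0 := by
      refine eq_zero_of_orthogonal hx hN (fun v ↦ ?_) ((gbar.symm _ _ _).trans (hk none))
      have h0 : (gbar.val (x p) (t.symmL ℝ (x p) a) ∘L dmap x p).toLinearMap = 0 := by
        refine b.ext fun j ↦ ?_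
        have := hk (some j)
        simp only [F, e, Option.elim_some, FiberBundle.extend_apply_self] at this
        rw [gbar.symm] at this
        exact this
      exact congrArg (fun f ↦ f v) h0
    have h := t.continuousLinearMapAt_symmL (R := ℝ) hb a
    rw [← h, hw, map_zero]
  · filter_upwards [hbase] with q hq
    have h1 : t.symmL ℝ (x q) (coordAlong x (fun q ↦ dmap x q (rigged gbar x N q)) p q) =
        dmap x q (rigged gbar x N q) := by
      rw [Trivialization.symmL_apply _ hq]
      exact t.symm_apply_apply_mk hq _
    obtain ⟨hr, hr1⟩ := rigged_spec hx hN q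
    ext k
    simp only [A, ContinuousLinearMap.pi_apply, ContinuousLinearMap.comp_apply, h1]
    cases k with
    | none => simpa [F, eta] using hr1
    | some j =>
      rw [gbar.symm]
      simpa [F, pullbackMetric] using hr (e j q)

/-! ### Transformation laws and the coincidence conditions. -/

lemma shapeN_smul (hx : IsNullHypersurface gbar x) (hN : IsNullRigging gbar x N) {φ : M → ℝ}
    (hφ : ContMDiff (𝓡 n) 𝓘(ℝ, ℝ) ∞ φ) (hφ_ne : ∀ p, φ p ≠ 0) (p : M)
    (v : TangentSpace (𝓡 n) p) :
    shapeN gbar x (fun p ↦ φ p • N p) p v = φ p • shapeN gbar x N p v := by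
  have hNd := mdifferentiableAt_along_iff.1 ((hN.contMDiff p).mdifferentiableAt (by simp))
  have h := tangentialPart_smul_add hx hN (φ p) (dfun φ p v) (0 : TangentSpace (𝓡 n) p)
    (covAlong gbar x N p v)
  rw [map_zero, zero_add, zero_add] at h
  rw [shapeN, shapeN, tangentialPart_smul hφ_ne,
    covAlong_smul hNd.1.continuousAt ((hφ p).mdifferentiableAt (by simp)) hNd.2, h, smul_neg]

/-- Pair `dφ(v) N + φ ∇bar_v N` with `φ⁻¹ ξ` and use `gbar(N, ξ) = 1`. -/
lemma rotation_smul (hx : IsNullHypersurface gbar x) (hN : IsNullRigging gbar x N) {φ : M → ℝ}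
    (hφ : ContMDiff (𝓡 n) 𝓘(ℝ, ℝ) ∞ φ) (hφ_ne : ∀ p, φ p ≠ 0) (p : M)
    (v : TangentSpace (𝓡 n) p) :
    rotation gbar x (fun p ↦ φ p • N p) p v = dfun φ p v / φ p + rotation gbar x N p v := by
  have hNd := mdifferentiableAt_along_iff.1 ((hN.contMDiff p).mdifferentiableAt (by simp))
  have h1 : gbar.val (x p) (N p) (dmap x p (rigged gbar x N p)) = 1 := (rigged_spec hx hN p).2
  have := hφ_ne p
  rw [rotation, rotation, rigged_smul hx hN (isNullRigging_smul hN hφ hφ_ne) hφ_ne,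
    covAlong_smul hNd.1.continuousAt ((hφ p).mdifferentiableAt (by simp)) hNd.2, map_add,
    map_smul, map_smul, map_smul, add_apply, smul_apply, smul_apply, map_smul, map_smul, h1]
  simp only [smul_eq_mul]
  field_simp

lemma rotation_smul_direction (c : ℝ) (v : TangentSpace (𝓡 n) p) :
    rotation gbar x N p (c • v) = c * rotation gbar x N p v := by
  have hb := FiberBundle.mem_baseSet_trivializationAt' (F := EuclideanSpace ℝ (Fin (n + 1)))
    (E := (TangentSpace (𝓡 (n + 1)) : M' → Type _)) (x p)
  have hc : covAlong gbar x N p (c • v) = c • covAlong gbar x N p v := by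
    have hL := leviCivita_smul_direction gbar (FiberBundle.mdifferentiableAt_extend (𝓡 (n + 1))
      (EuclideanSpace ℝ (Fin (n + 1))) (N p)) c (dmap x p v)
    rw [covAlong, covAlong, map_smul, map_smul, hL, smul_add,
      ← Trivialization.coe_symmₗ (R := ℝ) _ hb, map_smul]
  rw [rotation, rotation, hc, map_smul, smul_apply, smul_eq_mul]

/-- Here `∇_v(φ⁻¹ ξ) = d(φ⁻¹)(v) ξ + φ⁻¹ ∇_v ξ`, and the screen projection, itself unchanged by
rescaling, removes the first term. -/
lemma shapeXi_smul (hx : IsNullHypersurface gbar x) (hN : IsNullRigging gbar x N) {φ : M → ℝ}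
    (hφ : ContMDiff (𝓡 n) 𝓘(ℝ, ℝ) ∞ φ) (hφ_ne : ∀ p, φ p ≠ 0) (p : M)
    (v : TangentSpace (𝓡 n) p) :
    shapeXi gbar x (fun p ↦ φ p • N p) p v = (φ p)⁻¹ • shapeXi gbar x N p v := by
  have hN' := isNullRigging_smul hN hφ hφ_ne
  have hinv : MDifferentiableAt (𝓡 n) 𝓘(ℝ, ℝ) (fun q ↦ (φ q)⁻¹) p :=
    ((hφ.inv₀ hφ_ne) p).mdifferentiableAt (by simp)
  have hind : inducedConnection gbar x N (rigged gbar x (fun p ↦ φ p • N p)) p v =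
      dfun (fun q ↦ (φ q)⁻¹) p v • rigged gbar x N p +
        (φ p)⁻¹ • inducedConnection gbar x N (rigged gbar x N) p v := by
    have h := tangentialPart_smul_add hx hN (φ p)⁻¹ 0
      (dfun (fun q ↦ (φ q)⁻¹) p v • rigged gbar x N p)
      (covAlong gbar x (fun q ↦ dmap x q (rigged gbar x N q)) p v)
    rw [inducedConnection, inducedConnection, ← h]
    simp only [rigged_smul hx hN hN' hφ_ne, map_smul]
    rw [covAlong_smul (hx.contMDiff p).continuousAt hinv
      (mdifferentiableAt_coordAlong_rigged hx hN p), zero_smul, add_zero]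
  rw [shapeXi, shapeXi, inducedConnection_smul hφ_ne, screenProj_smul hx hN hN' hφ_ne, hind,
    screenProj_smul_rigged_add hx hN, smul_neg]

lemma dfun_div_sq {α φ : M → ℝ}
    (hφ : MDifferentiableAt (𝓡 n) 𝓘(ℝ, ℝ) φ p) (hq : MDifferentiableAt (𝓡 n) 𝓘(ℝ, ℝ)
      (fun q ↦ α q / φ q ^ 2) p) (hφ_ne : ∀ p, φ p ≠ 0) (v : TangentSpace (𝓡 n) p) :
    dfun (fun q ↦ α q / φ q ^ 2) p v = dfun α p v / φ p ^ 2 - 2 * α p * dfun φ p v / φ p ^ 3 := by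
  -- Instead of a quotient rule: apply the product rule to `α = φ² (α/φ²)` and solve for the
  -- derivative of the quotient.
  have hαe : α = fun q ↦ φ q * φ q * (α q / φ q ^ 2) := by
    ext q
    have := hφ_ne q
    field_simp
  have h := dfun_mul (hφ.mul hφ) hq v
  have h2 := dfun_mul hφ hφ v
  have h3 : dfun α p v = φ p * φ p * dfun (fun q ↦ α q / φ q ^ 2) p v +
      α p / φ p ^ 2 * (φ p * dfun φ p v + φ p * dfun φ p v) := by
    rw [← h2]
    conv_lhs => rw [hαe]
    exact h
  have := hφ_ne p
  rw [h3]
  field_simp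
  ring

lemma coincidenceConditions_smul (hx : IsNullHypersurface gbar x) (hN : IsNullRigging gbar x N)
    {α φ : M → ℝ} (hα : ContMDiff (𝓡 n) 𝓘(ℝ, ℝ) ∞ α) (hφ : ContMDiff (𝓡 n) 𝓘(ℝ, ℝ) ∞ φ)
    (hφ_ne : ∀ p, φ p ≠ 0) (h : CoincidenceConditions gbar x N α) :
    CoincidenceConditions gbar x (fun p ↦ φ p • N p) (fun p ↦ α p / φ p ^ 2) := by
  refine ⟨fun p v ↦ ?_, fun p ↦ ?_⟩
  · have := hφ_ne p
    rw [shapeXi_smul hx hN hφ hφ_ne, shapeN_smul hx hN hφ hφ_ne, h.1, smul_smul, smul_smul]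
    congr 1
    field_simp
  · have h2 := h.2 p
    have := hφ_ne p
    have hd := dfun_div_sq
      ((hφ p).mdifferentiableAt (by simp))
      ((hα.div₀ (hφ.pow 2) fun q ↦ pow_ne_zero 2 (hφ_ne q)) p |>.mdifferentiableAt (by simp))
      hφ_ne (rigged gbar x N p)
    rw [rotation_smul hx hN hφ hφ_ne, rigged_smul hx hN (isNullRigging_smul hN hφ hφ_ne) hφ_ne,
      rotation_smul_direction]
    simp only [dfun, map_smul, smul_eq_mul] at hd h2 ⊢
    rw [hd]
    field_simp
    -- The `dφ(ξ)` contributions cancel, and a multiple of the original condition remains.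
    linear_combination φ p * h2

end Hypersurface

end NullHypersurface

theorem mainTheorem4 {n : ℕ}
    {M : Type*} [TopologicalSpace M] [ChartedSpace (EuclideanSpace ℝ (Fin n)) M]
    [IsManifold (𝓡 n) ∞ M]
    {M' : Type*} [TopologicalSpace M'] [ChartedSpace (EuclideanSpace ℝ (Fin (n + 1))) M']
    [IsManifold (𝓡 (n + 1)) ∞ M']
    (gbar : NullHypersurface.SemiRiemannianMetric (n + 1) M') (x : M → M')
    (hx : NullHypersurface.IsNullHypersurface gbar x)
    (N : ∀ p : M, TangentSpace (𝓡 (n + 1)) (x p))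
    (hN : NullHypersurface.IsNullRigging gbar x N)
    (α : M → ℝ) (hα : ContMDiff (𝓡 n) 𝓘(ℝ, ℝ) ∞ α)
    (φ : M → ℝ) (hφ : ContMDiff (𝓡 n) 𝓘(ℝ, ℝ) ∞ φ) (hφ_ne : ∀ p, φ p ≠ 0)
    (hφ_leaf : NullHypersurface.IsConstantOnScreenLeaves gbar x N φ) :
    NullHypersurface.IsNullRigging gbar x (fun p ↦ φ p • N p) ∧
    (NullHypersurface.CoincidenceConditions gbar x N α →
      NullHypersurface.CoincidenceConditions gbar x (fun p ↦ φ p • N p)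
        (fun p ↦ α p / φ p ^ 2)) ∧
    ((∀ p, α p ≠ 0) → NullHypersurface.ConnectionsCoincide gbar x N α →
      NullHypersurface.ConnectionsCoincide gbar x (fun p ↦ φ p • N p)
        (fun p ↦ α p / φ p ^ 2)) := by
  exact ⟨NullHypersurface.isNullRigging_smul hN hφ hφ_ne,
    NullHypersurface.coincidenceConditions_smul hx hN hα hφ hφ_ne,
    fun _ h Y hY p v ↦ by
      rw [NullHypersurface.associatedMetric_smul hφ_ne,
        NullHypersurface.inducedConnection_smul hφ_ne]
      exact h Y hY p v⟩
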